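/- Let $R$ be an associative ring with identity, let "module" mean left $R$-module, and let $\mathfrak X$ be a class of modules containing all projective modules. A module $G$ is called $\mathfrak X$-Gorenstein projective if there is an exact sequence $\cdots\to P_1\to P_0\to P^0\to P^1\to\cdots$ of projective modules that remains exact after applying $\operatorname{Hom}_R(-,X)$ for every $X\in\mathfrak X$ and such that $G\cong\operatorname{Ker}(P_0\to P^0)$. For a module $M$, let $\mathfrak X\text{-}\mathrm{Gpd}(M)\in\{0,1,2,\dots\}\cup\{\infty\}$ be the infimum of the integers $n\ge 0$ for which there is an exact sequence $0\to G_n\to\cdots\to G_1\to G_0\to M\to 0$ with every $G_i$ $\mathfrak X$-Gorenstein projective (and $\infty$ if there is none), and put $l.\mathfrak X\text{-}\mathrm{Ggldim}(R)=\sup\{\mathfrak X\text{-}\mathrm{Gpd}(M)\mid M\text{ a left }R\text{-module}\}$. Then for every integer $n\ge 0$ the following are equivalent: (1) $l.\mathfrak X\text{-}\mathrm{Ggldim}(R)\le n$; (2) $\mathfrak X\text{-}\mathrm{Gpd}(M)\le n$ for every finitely generated left $R$-module $M$; (3) $\mathfrak X\text{-}\mathrm{Gpd}(R/I)\le n$ for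 every left ideal $I$ of $R$. Consequently, $$l.\mathfrak X\text{-}\mathrm{Ggldim}(R)=\sup\{\mathfrak X\text{-}\mathrm{Gpd}(M)\mid M\text{ a finitely generated left }R\text{-module}\}=\sup\{\mathfrak X\text{-}\mathrm{Gpd}(R/I)\mid I\text{ a left ideal of }R\}.$$ -/

import Mathlib

open CategoryTheory

universe u

/-- The data of a doubly infinite sequence of left `R`-modules
`⋯ → P_1 → P_0 → P^0 → P^1 → ⋯`, with `left n = P_n` and `right n = P^n`. -/
structure TwoSidedSequence (R : Type u) [Ring R] where
  left : ℕ → ModuleCat.{u} R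
  right : ℕ → ModuleCat.{u} R
  dLeft : ∀ n, left (n + 1) ⟶ left n
  mid : left 0 ⟶ right 0
  dRight : ∀ n, right n ⟶ right (n + 1)

namespace TwoSidedSequence

variable {R : Type u} [Ring R]

/-- Exactness of the sequence at each of its terms. -/
structure IsExact (P : TwoSidedSequence R) : Prop where
  left_succ : ∀ n, Function.Exact (P.dLeft (n + 1)).hom (P.dLeft n).hom
  left_zero : Function.Exact (P.dLeft 0).hom P.mid.hom
  right_zero : Function.Exact P.mid.hom (P.dRight 0).hom
  right_succ : ∀ n, Function.Exact (P.dRight n).hom (P.dRight (n + 1)).hom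

/-- Exactness, at each of its terms, of the sequence of abelian groups
`⋯ → Hom(P^1, X) → Hom(P^0, X) → Hom(P_0, X) → Hom(P_1, X) → ⋯`. -/
structure IsHomExact (P : TwoSidedSequence R) (X : ModuleCat.{u} R) : Prop where
  left_succ : ∀ n, Function.Exact
    (fun f : P.left n ⟶ X => P.dLeft n ≫ f)
    (fun f : P.left (n + 1) ⟶ X => P.dLeft (n + 1) ≫ f)
  left_zero : Function.Exact
    (fun f : P.right 0 ⟶ X => P.mid ≫ f)
    (fun f : P.left 0 ⟶ X => P.dLeft 0 ≫ f)
  right_zero : Function.Exact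
    (fun f : P.right 1 ⟶ X => P.dRight 0 ≫ f)
    (fun f : P.right 0 ⟶ X => P.mid ≫ f)
  right_succ : ∀ n, Function.Exact
    (fun f : P.right (n + 2) ⟶ X => P.dRight (n + 1) ≫ f)
    (fun f : P.right (n + 1) ⟶ X => P.dRight n ≫ f)

/-- `P` is an exact sequence of projective modules that remains exact under `Hom(-, X)` for every
`X` in the class `𝔛`. -/
structure IsCompleteProjective (𝔛 : ObjectProperty (ModuleCat.{u} R))
    (P : TwoSidedSequence R) : Prop where
  projective_left : ∀ n, Module.Projective R (P.left n)
  projective_right : ∀ n, Module.Projective R (P.right n)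
  exact : P.IsExact
  hom_exact : ∀ X : ModuleCat.{u} R, 𝔛 X → P.IsHomExact X

end TwoSidedSequence

section XGorenstein

variable {R : Type u} [Ring R]

/-- `G` is `𝔛`-Gorenstein projective: `G` is (isomorphic to) the kernel of `P_0 → P^0` for some
`𝔛`-complete projective resolution `P`. -/
def IsXGorensteinProjective (𝔛 : ObjectProperty (ModuleCat.{u} R)) (G : ModuleCat.{u} R) : Prop :=
  ∃ P : TwoSidedSequence R, P.IsCompleteProjective 𝔛 ∧
    Nonempty (G ≃ₗ[R] LinearMap.ker P.mid.hom)

/-- An exact sequence `0 → G_n → ⋯ → G_1 → G_0 → M → 0` with every `G_i` `𝔛`-Gorenstein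
projective; the terms beyond degree `n` are zero modules. -/
structure XGorensteinResolution (𝔛 : ObjectProperty (ModuleCat.{u} R)) (M : ModuleCat.{u} R)
    (n : ℕ) where
  obj : ℕ → ModuleCat.{u} R
  d : ∀ i, obj (i + 1) ⟶ obj i
  augmentation : obj 0 ⟶ M
  augmentation_surjective : Function.Surjective augmentation.hom
  exact_zero : Function.Exact (d 0).hom augmentation.hom
  exact_succ : ∀ i, Function.Exact (d (i + 1)).hom (d i).hom
  gorenstein : ∀ i ≤ n, IsXGorensteinProjective 𝔛 (obj i)
  zero_of_lt : ∀ i, n < i → Subsingleton (obj i)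

/-- The `𝔛`-Gorenstein projective dimension; it is `⊤` when there is no finite resolution. -/
noncomputable def xGpd (𝔛 : ObjectProperty (ModuleCat.{u} R)) (M : ModuleCat.{u} R) : ℕ∞ :=
  sInf {k : ℕ∞ | ∃ n : ℕ, k = n ∧ Nonempty (XGorensteinResolution 𝔛 M n)}

/-- The left `𝔛`-Gorenstein global projective dimension of `R`. -/
noncomputable def leftXGgldim (𝔛 : ObjectProperty (ModuleCat.{u} R)) : ℕ∞ :=
  ⨆ M : ModuleCat.{u} R, xGpd 𝔛 M

end XGorenstein

/-!
Let `𝒲` be the class of modules `W` with `Extⁱ(G, W) = 0` for every `𝔛`-Gorenstein projective `G`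
and `i > 0`. A module of `𝔛`-Gorenstein projective dimension at most `n` has no `Extⁱ` into `𝒲` for
`i > n`. If this applies to all `R ⧸ I`, Baer's criterion and dimension shifting show that the
members of `𝒲` have injective dimension at most `n`, so that `Extⁱ(M, 𝒲) = 0` for all `M` and
`i > n`.

It remains to see that every `G` with `Extⁱ(G, 𝒲) = 0` for `i > 0` is `𝔛`-Gorenstein projective:
then `n`-th syzygies of arbitrary modules are. Descending from `n`, one embeds `G` into some
`V` in `𝒲` whose cokernel is again left orthogonal to `𝒲`. Now `V` is also left orthogonal to
`𝒲`, and such a module is projective, because `𝒲` is resolving and so contains the kernel of a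
projective presentation of `V`. Iterating gives the right half of a complete resolution of `G`.
-/

universe w

open Abelian Limits

section ExtDimensionShifting

variable {C : Type*} [Category* C] [Abelian C] [HasExt.{w} C] {S : ShortComplex C}

lemma subsingleton_ext_of_iso_left {X X' Y : C} (e : X ≅ X') {n : ℕ}
    (h : Subsingleton (Ext X Y n)) : Subsingleton (Ext X' Y n) := by
  refine subsingleton_of_forall_eq 0 fun x => ?_
  rw [← Ext.mk₀_id_comp x, ← e.inv_hom_id, ← Ext.mk₀_comp_mk₀_assoc,
    Subsingleton.elim ((Ext.mk₀ e.hom).comp x (zero_add n)) 0, Ext.comp_zero]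

lemma subsingleton_ext_X₁_left (hS : S.ShortExact) {Y : C} {n : ℕ}
    (h₂ : Subsingleton (Ext S.X₂ Y n)) (h₃ : Subsingleton (Ext S.X₃ Y (n + 1))) :
    Subsingleton (Ext S.X₁ Y n) := by
  refine subsingleton_of_forall_eq 0 fun x => ?_
  obtain ⟨y, rfl⟩ := Ext.contravariant_sequence_exact₁ hS Y x (add_comm 1 n)
    (Subsingleton.elim _ _)
  rw [Subsingleton.elim y 0, Ext.comp_zero]

lemma subsingleton_ext_X₂_left (hS : S.ShortExact) {Y : C} {n : ℕ}
    (h₁ : Subsingleton (Ext S.X₁ Y n)) (h₃ : Subsingleton (Ext S.X₃ Y n)) :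
    Subsingleton (Ext S.X₂ Y n) := by
  refine subsingleton_of_forall_eq 0 fun x => ?_
  obtain ⟨y, rfl⟩ := Ext.contravariant_sequence_exact₂ hS Y x (Subsingleton.elim _ _)
  rw [Subsingleton.elim y 0, Ext.comp_zero]

lemma subsingleton_ext_X₃_left (hS : S.ShortExact) {Y : C} {n : ℕ}
    (h₁ : Subsingleton (Ext S.X₁ Y n)) (h₂ : Subsingleton (Ext S.X₂ Y (n + 1))) :
    Subsingleton (Ext S.X₃ Y (n + 1)) := by
  refine subsingleton_of_forall_eq 0 fun x => ?_
  obtain ⟨y, rfl⟩ := Ext.contravariant_sequence_exact₃ hS Y x (Subsingleton.elim _ _)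
    (add_comm 1 n)
  rw [Subsingleton.elim y 0, Ext.comp_zero]

lemma subsingleton_ext_X₁_right (hS : S.ShortExact) {X : C} {n : ℕ}
    (h₂ : Subsingleton (Ext X S.X₂ (n + 1))) (h₃ : Subsingleton (Ext X S.X₃ n)) :
    Subsingleton (Ext X S.X₁ (n + 1)) := by
  refine subsingleton_of_forall_eq 0 fun x => ?_
  obtain ⟨y, rfl⟩ := Ext.covariant_sequence_exact₁ X hS x (Subsingleton.elim _ _) rfl
  rw [Subsingleton.elim y 0, Ext.zero_comp]

lemma subsingleton_ext_X₂_right (hS : S.ShortExact) {X : C} {n : ℕ}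
    (h₁ : Subsingleton (Ext X S.X₁ n)) (h₃ : Subsingleton (Ext X S.X₃ n)) :
    Subsingleton (Ext X S.X₂ n) := by
  refine subsingleton_of_forall_eq 0 fun x => ?_
  obtain ⟨y, rfl⟩ := Ext.covariant_sequence_exact₂ X hS x (Subsingleton.elim _ _)
  rw [Subsingleton.elim y 0, Ext.zero_comp]

lemma subsingleton_ext_X₃_right (hS : S.ShortExact) {X : C} {n : ℕ}
    (h₁ : Subsingleton (Ext X S.X₁ (n + 1))) (h₂ : Subsingleton (Ext X S.X₂ n)) :
    Subsingleton (Ext X S.X₃ n) := by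
  refine subsingleton_of_forall_eq 0 fun x => ?_
  obtain ⟨y, rfl⟩ := Ext.covariant_sequence_exact₃ X hS x rfl (Subsingleton.elim _ _)
  rw [Subsingleton.elim y 0, Ext.zero_comp]

lemma subsingleton_ext_of_projective (P Y : C) [Projective P] {n : ℕ} (hn : 0 < n) :
    Subsingleton (Ext P Y n) :=
  HasProjectiveDimensionLT.subsingleton P 1 n hn Y

lemma subsingleton_ext_of_injective (X E : C) [Injective E] {n : ℕ} (hn : 0 < n) :
    Subsingleton (Ext X E n) :=
  HasInjectiveDimensionLT.subsingleton E 1 n hn X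

lemma exists_extension_of_subsingleton_ext_one (hS : S.ShortExact) {Y : C}
    (h : Subsingleton (Ext S.X₃ Y 1)) (f : S.X₁ ⟶ Y) : ∃ g : S.X₂ ⟶ Y, S.f ≫ g = f := by
  obtain ⟨x, hx⟩ := Ext.contravariant_sequence_exact₁ hS Y (Ext.mk₀ f) (add_zero 1)
    (Subsingleton.elim _ _)
  obtain ⟨g, rfl⟩ := Ext.homEquiv₀.symm.surjective x
  exact ⟨g, Ext.homEquiv₀.symm.injective (by simpa using hx)⟩

lemma subsingleton_ext_one_of_forall_extension (hS : S.ShortExact) (hP : Projective S.X₂) {Y : C}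
    (h : ∀ f : S.X₁ ⟶ Y, ∃ g : S.X₂ ⟶ Y, S.f ≫ g = f) : Subsingleton (Ext S.X₃ Y 1) := by
  have := subsingleton_ext_of_projective S.X₂ Y one_pos
  refine subsingleton_of_forall_eq 0 fun x => ?_
  obtain ⟨y, rfl⟩ := Ext.contravariant_sequence_exact₃ hS Y x (Subsingleton.elim _ _) (add_zero 1)
  obtain ⟨f, rfl⟩ := Ext.homEquiv₀.symm.surjective y
  obtain ⟨g, rfl⟩ := h f
  simp [← Ext.mk₀_comp_mk₀]

lemma exists_section_of_subsingleton_ext_one (hS : S.ShortExact)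
    (h : Subsingleton (Ext S.X₃ S.X₁ 1)) : ∃ s : S.X₃ ⟶ S.X₂, s ≫ S.g = 𝟙 S.X₃ := by
  obtain ⟨x, hx⟩ := Ext.covariant_sequence_exact₃ S.X₃ hS (Ext.mk₀ (𝟙 S.X₃)) (zero_add 1)
    (Subsingleton.elim _ _)
  obtain ⟨s, rfl⟩ := Ext.homEquiv₀.symm.surjective x
  exact ⟨s, Ext.homEquiv₀.symm.injective (by simpa using hx)⟩

end ExtDimensionShifting

section ShortExact

variable {C : Type*} [Category* C] [Abelian C] {S : ShortComplex C}

lemma exists_shortExact_of_isPullback (hS : S.ShortExact) {T Y : C} {a : T ⟶ S.X₂} {b : T ⟶ Y}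
    {y : Y ⟶ S.X₃} (sq : IsPullback a b S.g y) :
    ∃ (f : S.X₁ ⟶ T) (w : f ≫ b = 0), (ShortComplex.mk f b w).ShortExact := by
  have := hS.mono_f
  have := hS.epi_g
  have hw : S.f ≫ S.g = 0 ≫ y := by rw [S.zero, zero_comp]
  have hfa : sq.lift S.f 0 hw ≫ a = S.f := sq.lift_fst _ _ _
  have hfb : sq.lift S.f 0 hw ≫ b = 0 := sq.lift_snd _ _ _
  have hmono : Mono (sq.lift S.f 0 hw) := mono_of_mono_fac hfa
  have hker (Z : C) (t : Z ⟶ T) (ht : t ≫ b = 0) : (t ≫ a) ≫ S.g = 0 := by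
    rw [Category.assoc, sq.w, reassoc_of% ht, zero_comp]
  refine ⟨_, hfb, ShortComplex.ShortExact.mk' (ShortComplex.exact_of_f_is_kernel _ ?_) hmono
    (Abelian.epi_snd_of_isLimit _ _ sq.isLimit)⟩
  exact KernelFork.IsLimit.ofι' _ _ fun {Z} t ht => ⟨hS.exact.lift (t ≫ a) (hker Z t ht),
    sq.hom_ext (by simp [hfa]) (by simp [hfb, ht])⟩

lemma exists_shortExact_of_isPullback_of_epi (hS : S.ShortExact) {T F : C} {a : T ⟶ S.X₁}
    {b : T ⟶ F} {p : F ⟶ S.X₂} [Epi p] (sq : IsPullback a b S.f p) :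
    ∃ w : b ≫ p ≫ S.g = 0, (ShortComplex.mk b (p ≫ S.g) w).ShortExact := by
  have := hS.mono_f
  have := hS.epi_g
  have hw : b ≫ p ≫ S.g = 0 := by rw [← sq.w_assoc, S.zero, comp_zero]
  have hmono : Mono b := (MorphismProperty.monomorphisms C).of_isPullback sq ‹Mono S.f›
  refine ⟨hw, ShortComplex.ShortExact.mk' (ShortComplex.exact_of_f_is_kernel _ ?_) hmono
    (epi_comp p S.g)⟩
  exact KernelFork.IsLimit.ofι' _ _ fun {Z} t ht =>
    ⟨sq.lift (hS.exact.lift (t ≫ p) (by simpa using ht)) t (by simp), sq.lift_snd _ _ _⟩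

lemma shortExact_injective_ι [EnoughInjectives C] (M : C) :
    (ShortComplex.mk (Injective.ι M) (cokernel.π _) (cokernel.condition _)).ShortExact :=
  .mk' (ShortComplex.exact_cokernel _) inferInstance inferInstance

lemma hom_exact_splice (hS : S.ShortExact) {A D X : C} {p : A ⟶ S.X₁} {j : S.X₃ ⟶ D} (hp : Epi p)
    (hj : ∀ f : S.X₃ ⟶ X, ∃ h : D ⟶ X, j ≫ h = f) :
    Function.Exact (fun f : D ⟶ X => (S.g ≫ j) ≫ f) (fun f : S.X₂ ⟶ X => (p ≫ S.f) ≫ f) := by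
  have := hS.epi_g
  intro f
  constructor
  · intro hf
    have hSf : S.f ≫ f = 0 := (cancel_epi p).1 (by simpa using hf)
    obtain ⟨h, hh⟩ := hj (hS.exact.desc f hSf)
    exact ⟨h, by simp [hh]⟩
  · rintro ⟨h, rfl⟩
    simp

end ShortExact

section Orthogonality

variable {C : Type*} [Category* C] [Abelian C]

/-- `K` is a first syzygy of `G`: there is a short exact sequence `0 → K → P → G → 0` with `P`
projective. -/
def IsSyzygy (K G : C) : Prop :=
  ∃ (P : C) (i : K ⟶ P) (p : P ⟶ G) (w : i ≫ p = 0),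
    Projective P ∧ (ShortComplex.mk i p w).ShortExact

/-- A resolving class: it contains the projective objects and is closed under extensions and
kernels of epimorphisms. Closure under direct summands, which some authors add, is not required. -/
structure IsResolving (𝒲 : ObjectProperty C) : Prop where
  of_projective (P : C) : Projective P → 𝒲 P
  prop_X₂ {S : ShortComplex C} : S.ShortExact → 𝒲 S.X₁ → 𝒲 S.X₃ → 𝒲 S.X₂
  prop_X₁ {S : ShortComplex C} : S.ShortExact → 𝒲 S.X₂ → 𝒲 S.X₃ → 𝒲 S.X₁

/-- `M` embeds into an object of `𝒱` with cokernel in `𝒢`; when every `Ext¹(G, V)` with `G` in `𝒢`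
and `V` in `𝒱` vanishes, such an embedding is a special `𝒱`-preenvelope. -/
def HasSpecialPreenvelope (𝒱 𝒢 : ObjectProperty C) (M : C) : Prop :=
  ∃ (V G : C) (f : M ⟶ V) (g : V ⟶ G) (w : f ≫ g = 0),
    𝒱 V ∧ 𝒢 G ∧ (ShortComplex.mk f g w).ShortExact

lemma IsSyzygy.congr {K K' G G' : C} (h : IsSyzygy K G) (e : K ≅ K') (e' : G ≅ G') :
    IsSyzygy K' G' := by
  obtain ⟨P, i, p, w, hP, hS⟩ := h
  have w' : (e.inv ≫ i) ≫ p ≫ e'.hom = 0 := by simp [reassoc_of% w]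
  exact ⟨P, e.inv ≫ i, p ≫ e'.hom, w', hP, ShortComplex.shortExact_of_iso
    (ShortComplex.isoMk e (.refl P) e' (by simp) (by simp)) hS⟩

lemma exists_isSyzygy [EnoughProjectives C] (G : C) : ∃ K, IsSyzygy K G :=
  ⟨_, _, _, Projective.π G, kernel.condition _, inferInstance,
    .mk' (ShortComplex.exact_kernel _) inferInstance inferInstance⟩

variable [HasExt.{w} C]

/-- The class `𝒢^⊥` of the objects `W` with `Extⁱ(G, W) = 0` for all `G` in `𝒢` and `i > 0`. -/
def rightExtOrthogonal (𝒢 : ObjectProperty C) : ObjectProperty C :=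
  fun W => ∀ G, 𝒢 G → ∀ i, 0 < i → Subsingleton (Ext G W i)

/-- The class of the objects `X` of projective dimension at most `d` relative to `𝒲`:
`Extⁱ(X, W) = 0` for all `W` in `𝒲` and `i > d`. For `d = 0` this is the class `^⊥𝒲`. -/
def leftExtOrthogonal (𝒲 : ObjectProperty C) (d : ℕ) : ObjectProperty C :=
  fun X => ∀ W, 𝒲 W → ∀ i, d < i → Subsingleton (Ext X W i)

variable {𝒲 𝒢 : ObjectProperty C} {S : ShortComplex C} {d : ℕ}

lemma leftExtOrthogonal_of_projective (P : C) [Projective P] : leftExtOrthogonal 𝒲 d P :=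
  fun W _ _ hi => subsingleton_ext_of_projective P W (Nat.zero_lt_of_lt hi)

lemma leftExtOrthogonal_X₁ (hS : S.ShortExact) (h₂ : leftExtOrthogonal 𝒲 d S.X₂)
    (h₃ : leftExtOrthogonal 𝒲 (d + 1) S.X₃) : leftExtOrthogonal 𝒲 d S.X₁ :=
  fun W hW i hi => subsingleton_ext_X₁_left hS (h₂ W hW i hi) (h₃ W hW (i + 1) (by lia))

lemma leftExtOrthogonal_X₂ (hS : S.ShortExact) (h₁ : leftExtOrthogonal 𝒲 d S.X₁)
    (h₃ : leftExtOrthogonal 𝒲 d S.X₃) : leftExtOrthogonal 𝒲 d S.X₂ :=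
  fun W hW i hi => subsingleton_ext_X₂_left hS (h₁ W hW i hi) (h₃ W hW i hi)

lemma leftExtOrthogonal_X₃ (hS : S.ShortExact) (h₁ : leftExtOrthogonal 𝒲 d S.X₁)
    (h₂ : leftExtOrthogonal 𝒲 (d + 1) S.X₂) : leftExtOrthogonal 𝒲 (d + 1) S.X₃ := by
  rintro W hW (_ | i) hi
  · exact absurd hi (Nat.not_lt_zero _)
  · exact subsingleton_ext_X₃_left hS (h₁ W hW i (by lia)) (h₂ W hW (i + 1) hi)

lemma leftExtOrthogonal_mono {d e : ℕ} (hde : d ≤ e) {X : C} (h : leftExtOrthogonal 𝒲 d X) :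
    leftExtOrthogonal 𝒲 e X :=
  fun W hW i hi => h W hW i (hde.trans_lt hi)

lemma IsSyzygy.leftExtOrthogonal {K G : C} (h : IsSyzygy K G)
    (hG : leftExtOrthogonal 𝒲 (d + 1) G) : leftExtOrthogonal 𝒲 d K := by
  obtain ⟨P, i, p, w, hP, hS⟩ := h
  exact leftExtOrthogonal_X₁ hS (leftExtOrthogonal_of_projective P) hG

lemma IsSyzygy.subsingleton_ext {K G Y : C} (h : IsSyzygy K G) {n : ℕ} (hn : 0 < n)
    (hG : Subsingleton (Ext G Y (n + 1))) : Subsingleton (Ext K Y n) := by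
  obtain ⟨P, i, p, w, hP, hS⟩ := h
  exact subsingleton_ext_X₁_left hS (subsingleton_ext_of_projective P Y hn) hG

lemma IsSyzygy.subsingleton_ext_succ {K G Y : C} (h : IsSyzygy K G) {n : ℕ}
    (hK : Subsingleton (Ext K Y n)) : Subsingleton (Ext G Y (n + 1)) := by
  obtain ⟨P, i, p, w, hP, hS⟩ := h
  exact subsingleton_ext_X₃_left hS hK (subsingleton_ext_of_projective P Y n.succ_pos)

lemma le_leftExtOrthogonal_rightExtOrthogonal :
    𝒢 ≤ leftExtOrthogonal (rightExtOrthogonal 𝒢) 0 :=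
  fun G hG _ hW => hW G hG

lemma rightExtOrthogonal_of_injective (E : C) [Injective E] : rightExtOrthogonal 𝒢 E :=
  fun G _ _ hi => subsingleton_ext_of_injective G E hi

lemma le_rightExtOrthogonal {𝒳 : ObjectProperty C}
    (hsyz : ∀ G, 𝒢 G → ∃ K, 𝒢 K ∧ IsSyzygy K G)
    (hext : ∀ G X, 𝒢 G → 𝒳 X → Subsingleton (Ext G X 1)) : 𝒳 ≤ rightExtOrthogonal 𝒢 := by
  intro X hX G hG i hi
  induction i, hi using Nat.le_induction generalizing G with
  | base => exact hext G X hG hX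
  | succ i _ ih =>
    obtain ⟨K, hK, hKG⟩ := hsyz G hG
    exact hKG.subsingleton_ext_succ (ih K hK)

lemma rightExtOrthogonal_isResolving
    (hcosyz : ∀ G, 𝒢 G → ∃ G', 𝒢 G' ∧ IsSyzygy G G')
    (hproj : ∀ P, Projective P → rightExtOrthogonal 𝒢 P) : IsResolving (rightExtOrthogonal 𝒢) where
  of_projective := hproj
  prop_X₂ hS h₁ h₃ G hG i hi := subsingleton_ext_X₂_right hS (h₁ G hG i hi) (h₃ G hG i hi)
  prop_X₁ hS h₂ h₃ G hG i hi := by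
    obtain ⟨G', hG', hGG'⟩ := hcosyz G hG
    exact hGG'.subsingleton_ext hi
      (subsingleton_ext_X₁_right hS (h₂ G' hG' (i + 1) i.succ_pos) (h₃ G' hG' i hi))

lemma IsResolving.projective_of_leftExtOrthogonal [EnoughProjectives C] (h𝒲 : IsResolving 𝒲)
    {V : C} (hV : 𝒲 V) (hV' : leftExtOrthogonal 𝒲 0 V) : Projective V := by
  obtain ⟨K, P, i, p, w, hP, hS⟩ := exists_isSyzygy V
  obtain ⟨s, hs⟩ := exists_section_of_subsingleton_ext_one hS
    (hV' K (h𝒲.prop_X₁ hS (h𝒲.of_projective P hP) hV) 1 one_pos)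
  exact (Retract.mk s p hs).projective

/-- The cokernel `M'` of `M → E`, with `E` injective, has a preenvelope `M' → V` whose cokernel has
relative dimension `d + 1`; pulling back first along a projective presentation of `V` and then along
`E → M'` lowers this dimension by one. -/
lemma IsResolving.hasSpecialPreenvelope_of_succ [EnoughProjectives C] [EnoughInjectives C]
    (h𝒲 : IsResolving 𝒲) (hinj : ∀ E, Injective E → 𝒲 E)
    (h : ∀ M, HasSpecialPreenvelope 𝒲 (leftExtOrthogonal 𝒲 (d + 1)) M) (M : C) :
    HasSpecialPreenvelope 𝒲 (leftExtOrthogonal 𝒲 d) M := by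
  have hE := shortExact_injective_ι M
  obtain ⟨V, G, f, g, w, hV, hG, hVG⟩ := h (cokernel (Injective.ι M))
  obtain ⟨K, P, i, p, w', hP, hPV⟩ := exists_isSyzygy V
  have hK : 𝒲 K := h𝒲.prop_X₁ hPV (h𝒲.of_projective P hP) hV
  have := hPV.epi_g
  let sq₁ := IsPullback.of_hasPullback p f
  let sq₂ := IsPullback.of_hasPullback (cokernel.π (Injective.ι M)) (pullback.snd p f)
  have hsyz : IsSyzygy (pullback p f) G := by
    obtain ⟨w₁, h₁⟩ := exists_shortExact_of_isPullback_of_epi hVG sq₁.flip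
    exact ⟨P, _, _, w₁, hP, h₁⟩
  obtain ⟨j, w₂, hj⟩ := exists_shortExact_of_isPullback hPV sq₁
  obtain ⟨k, w₃, hk⟩ := exists_shortExact_of_isPullback hj sq₂.flip
  obtain ⟨l, w₄, hl⟩ := exists_shortExact_of_isPullback hE sq₂
  exact ⟨_, _, l, _, w₄, h𝒲.prop_X₂ hk hK (hinj _ inferInstance), hsyz.leftExtOrthogonal hG, hl⟩

lemma IsResolving.hasSpecialPreenvelope [EnoughProjectives C] [EnoughInjectives C]
    (h𝒲 : IsResolving 𝒲) (hinj : ∀ E, Injective E → 𝒲 E) {n : ℕ}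
    (hn : ∀ X, leftExtOrthogonal 𝒲 n X) (M : C) :
    HasSpecialPreenvelope 𝒲 (leftExtOrthogonal 𝒲 0) M := by
  have hdescent (d : ℕ) (hd : ∀ M, HasSpecialPreenvelope 𝒲 (leftExtOrthogonal 𝒲 d) M) :
      ∀ M, HasSpecialPreenvelope 𝒲 (leftExtOrthogonal 𝒲 0) M := by
    induction d with
    | zero => exact hd
    | succ d ih => exact ih (h𝒲.hasSpecialPreenvelope_of_succ hinj hd)
  exact hdescent n (fun M => ⟨_, _, Injective.ι M, cokernel.π _, cokernel.condition _,
    hinj _ inferInstance, hn _, shortExact_injective_ι M⟩) M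

lemma IsResolving.exists_isSyzygy_of_leftExtOrthogonal [EnoughProjectives C] [EnoughInjectives C]
    (h𝒲 : IsResolving 𝒲) (hinj : ∀ E, Injective E → 𝒲 E) {n : ℕ}
    (hn : ∀ X, leftExtOrthogonal 𝒲 n X) {G : C} (hG : leftExtOrthogonal 𝒲 0 G) :
    ∃ G', leftExtOrthogonal 𝒲 0 G' ∧ IsSyzygy G G' := by
  obtain ⟨V, G', f, g, w, hV, hG', hS⟩ := h𝒲.hasSpecialPreenvelope hinj hn G
  exact ⟨G', hG', V, f, g, w,
    h𝒲.projective_of_leftExtOrthogonal hV (leftExtOrthogonal_X₂ hS hG hG'), hS⟩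

end Orthogonality

section BaerCriterion

variable {R : Type u} [Ring R]

lemma injective_of_forall_ideal_subsingleton_ext_one {W : ModuleCat.{u} R}
    (h : ∀ I : Ideal R, Subsingleton (Ext (ModuleCat.of R (R ⧸ I)) W 1)) : Injective W := by
  have hBaer : Module.Baer R W := fun I f => by
    have hS : (ModuleCat.shortComplexOfCompEqZero I.subtype I.mkQ
        (LinearMap.exact_subtype_mkQ I).linearMap_comp_eq_zero).ShortExact :=
      ModuleCat.shortComplex_shortExact _ (LinearMap.exact_subtype_mkQ I) I.injective_subtype
        I.mkQ_surjective
    obtain ⟨g, hg⟩ := exists_extension_of_subsingleton_ext_one hS (h I) (ModuleCat.ofHom f)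
    exact ⟨g.hom, fun x hx => ConcreteCategory.congr_hom hg ⟨x, hx⟩⟩
  have := hBaer.injective
  exact Module.injective_object_of_injective_module R W

lemma hasInjectiveDimensionLE_of_forall_ideal {n : ℕ} {W : ModuleCat.{u} R}
    (h : ∀ I : Ideal R, Subsingleton (Ext (ModuleCat.of R (R ⧸ I)) W (n + 1))) :
    HasInjectiveDimensionLE W n := by
  induction n generalizing W with
  | zero =>
    exact injective_iff_hasInjectiveDimensionLT_one.1
      (injective_of_forall_ideal_subsingleton_ext_one h)
  | succ n ih =>
    have hS := shortExact_injective_ι W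
    exact (hS.hasInjectiveDimensionLT_X₃_iff n inferInstance).1 <| ih fun I =>
      subsingleton_ext_X₃_right hS (h I) (subsingleton_ext_of_injective _ _ n.succ_pos)

end BaerCriterion

namespace TwoSidedSequence

variable {R : Type u} [Ring R]

/-- The sequence re-indexed so that its middle map is `P_1 → P_0`. -/
def shiftLeft (P : TwoSidedSequence R) : TwoSidedSequence R where
  left n := P.left (n + 1)
  right
    | 0 => P.left 0
    | n + 1 => P.right n
  dLeft n := P.dLeft (n + 1)
  mid := P.dLeft 0
  dRight
    | 0 => P.mid
    | n + 1 => P.dRight n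

/-- The sequence re-indexed so that its middle map is `P^0 → P^1`. -/
def shiftRight (P : TwoSidedSequence R) : TwoSidedSequence R where
  left
    | 0 => P.right 0
    | n + 1 => P.left n
  right n := P.right (n + 1)
  dLeft
    | 0 => P.mid
    | n + 1 => P.dLeft n
  mid := P.dRight 0
  dRight n := P.dRight (n + 1)

lemma IsCompleteProjective.shiftLeft {𝔛 : ObjectProperty (ModuleCat.{u} R)}
    {P : TwoSidedSequence R} (h : P.IsCompleteProjective 𝔛) :
    P.shiftLeft.IsCompleteProjective 𝔛 where
  projective_left n := h.projective_left (n + 1)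
  projective_right
    | 0 => h.projective_left 0
    | n + 1 => h.projective_right n
  exact :=
    { left_succ := fun n => h.exact.left_succ (n + 1)
      left_zero := h.exact.left_succ 0
      right_zero := h.exact.left_zero
      right_succ := fun
        | 0 => h.exact.right_zero
        | n + 1 => h.exact.right_succ n }
  hom_exact X hX :=
    { left_succ := fun n => (h.hom_exact X hX).left_succ (n + 1)
      left_zero := (h.hom_exact X hX).left_succ 0
      right_zero := (h.hom_exact X hX).left_zero
      right_succ := fun
        | 0 => (h.hom_exact X hX).right_zero
        | n + 1 => (h.hom_exact X hX).right_succ n }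

lemma IsCompleteProjective.shiftRight {𝔛 : ObjectProperty (ModuleCat.{u} R)}
    {P : TwoSidedSequence R} (h : P.IsCompleteProjective 𝔛) :
    P.shiftRight.IsCompleteProjective 𝔛 where
  projective_left
    | 0 => h.projective_right 0
    | n + 1 => h.projective_left n
  projective_right n := h.projective_right (n + 1)
  exact :=
    { left_succ := fun
        | 0 => h.exact.left_zero
        | n + 1 => h.exact.left_succ n
      left_zero := h.exact.right_zero
      right_zero := h.exact.right_succ 0
      right_succ := fun n => h.exact.right_succ (n + 1) }
  hom_exact X hX :=
    { left_succ := fun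
        | 0 => (h.hom_exact X hX).left_zero
        | n + 1 => (h.hom_exact X hX).left_succ n
      left_zero := (h.hom_exact X hX).right_zero
      right_zero := (h.hom_exact X hX).right_succ 0
      right_succ := fun n => (h.hom_exact X hX).right_succ (n + 1) }

/-- The module `Ker(P_0 → P^0)`. -/
abbrev syzygy (P : TwoSidedSequence R) : ModuleCat.{u} R :=
  ModuleCat.of R (LinearMap.ker P.mid.hom)

/-- The inclusion of `Ker(P_0 → P^0)` into `P_0`. -/
abbrev syzygyι (P : TwoSidedSequence R) : P.syzygy ⟶ P.left 0 :=
  ModuleCat.ofHom (LinearMap.ker P.mid.hom).subtype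

/-- The map `P_1 → Ker(P_0 → P^0)` through which `P_1 → P_0` factors. -/
abbrev IsExact.toSyzygy {P : TwoSidedSequence R} (h : P.IsExact) : P.left 1 ⟶ P.syzygy :=
  ModuleCat.ofHom ((P.dLeft 0).hom.codRestrict _ h.left_zero.apply_apply_eq_zero)

variable {P : TwoSidedSequence R}

lemma IsExact.dLeft_comp_toSyzygy (h : P.IsExact) : P.dLeft 1 ≫ h.toSyzygy = 0 :=
  ModuleCat.hom_ext <| LinearMap.ext fun x =>
    Subtype.ext ((h.left_succ 0).apply_apply_eq_zero x)

lemma IsExact.shortExact_syzygy (h : P.IsExact) :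
    ∃ w : P.shiftLeft.syzygyι ≫ h.toSyzygy = 0,
      (ShortComplex.mk P.shiftLeft.syzygyι h.toSyzygy w).ShortExact := by
  have hexact : Function.Exact P.shiftLeft.syzygyι.hom h.toSyzygy.hom := fun x =>
    Subtype.ext_iff.trans ⟨fun hx => ⟨⟨x, hx⟩, rfl⟩, by rintro ⟨y, rfl⟩; exact y.2⟩
  have hsurj : Function.Surjective h.toSyzygy.hom := by
    rintro ⟨y, hy⟩
    obtain ⟨x, hx⟩ := (h.left_zero y).1 hy
    exact ⟨x, Subtype.ext hx⟩
  exact ⟨ModuleCat.hom_ext hexact.linearMap_comp_eq_zero,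
    ModuleCat.shortComplex_shortExact _ hexact Subtype.val_injective hsurj⟩

variable {𝔛 : ObjectProperty (ModuleCat.{u} R)}

lemma IsCompleteProjective.isSyzygy (h : P.IsCompleteProjective 𝔛) :
    IsSyzygy P.shiftLeft.syzygy P.syzygy := by
  obtain ⟨w, hS⟩ := h.exact.shortExact_syzygy
  have := h.shiftLeft.projective_left 0
  exact ⟨_, _, _, w, ModuleCat.projective_of_categoryTheory_projective _, hS⟩

lemma IsCompleteProjective.subsingleton_ext_one (h : P.IsCompleteProjective 𝔛)
    {X : ModuleCat.{u} R} (hX : 𝔛 X) : Subsingleton (Ext P.syzygy X 1) := by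
  obtain ⟨w₀, hS₀⟩ := h.exact.shortExact_syzygy
  obtain ⟨w₁, hS₁⟩ := h.shiftLeft.exact.shortExact_syzygy
  have := h.projective_left 1
  have hP : Projective (P.left 1) := ModuleCat.projective_of_categoryTheory_projective _
  let p : P.left 2 ⟶ P.shiftLeft.syzygy := h.shiftLeft.exact.toSyzygy
  have hp : Epi p := hS₁.epi_g
  have hdp : P.dLeft 2 ≫ p = 0 := h.shiftLeft.exact.dLeft_comp_toSyzygy
  refine subsingleton_ext_one_of_forall_extension hS₀ hP fun f => ?_
  obtain ⟨g, hg⟩ := ((h.hom_exact X hX).left_succ 1 (p ≫ f)).1 <|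
    show P.dLeft 2 ≫ p ≫ f = 0 by rw [reassoc_of% hdp, zero_comp]
  exact ⟨g, (cancel_epi p).1 hg⟩

end TwoSidedSequence

namespace IsXGorensteinProjective

variable {R : Type u} [Ring R] {𝔛 : ObjectProperty (ModuleCat.{u} R)} {G : ModuleCat.{u} R}

lemma of_linearEquiv {G' : ModuleCat.{u} R} (hG : IsXGorensteinProjective 𝔛 G) (e : G ≃ₗ[R] G') :
    IsXGorensteinProjective 𝔛 G' := by
  obtain ⟨P, hP, ⟨f⟩⟩ := hG
  exact ⟨P, hP, ⟨e.symm.trans f⟩⟩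

lemma exists_isSyzygy (hG : IsXGorensteinProjective 𝔛 G) :
    ∃ K, IsXGorensteinProjective 𝔛 K ∧ IsSyzygy K G := by
  obtain ⟨P, hP, ⟨e⟩⟩ := hG
  exact ⟨_, ⟨_, hP.shiftLeft, ⟨.refl R _⟩⟩, hP.isSyzygy.congr (.refl _) e.symm.toModuleIso⟩

lemma exists_isSyzygy_of (hG : IsXGorensteinProjective 𝔛 G) :
    ∃ G', IsXGorensteinProjective 𝔛 G' ∧ IsSyzygy G G' := by
  obtain ⟨P, hP, ⟨e⟩⟩ := hG
  have h : IsSyzygy P.syzygy P.shiftRight.syzygy := hP.shiftRight.isSyzygy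
  exact ⟨_, ⟨_, hP.shiftRight, ⟨.refl R _⟩⟩, h.congr e.symm.toModuleIso (.refl _)⟩

lemma subsingleton_ext_one (hG : IsXGorensteinProjective 𝔛 G) {X : ModuleCat.{u} R} (hX : 𝔛 X) :
    Subsingleton (Ext G X 1) := by
  obtain ⟨P, hP, ⟨e⟩⟩ := hG
  exact subsingleton_ext_of_iso_left e.symm.toModuleIso (hP.subsingleton_ext_one hX)

end IsXGorensteinProjective

section Splicing

variable {R : Type u} [Ring R] {S : ShortComplex (ModuleCat.{u} R)} {A D : ModuleCat.{u} R}
  {p : A ⟶ S.X₁} {j : S.X₃ ⟶ D}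

lemma exact_splice (hS : S.ShortExact) (hp : Function.Surjective p.hom)
    (hj : Function.Injective j.hom) : Function.Exact (p ≫ S.f).hom (S.g ≫ j).hom :=
  hp.comp_exact_iff_exact.2 <| hj.comp_exact_iff_exact.2 <|
    (ShortComplex.ShortExact.moduleCat_exact_iff_function_exact S).1 hS.exact

lemma nonempty_linearEquiv_ker_comp (hS : S.ShortExact) (hj : Function.Injective j.hom) :
    Nonempty (S.X₁ ≃ₗ[R] LinearMap.ker (S.g ≫ j).hom) := by
  have hrange : LinearMap.range S.f.hom = LinearMap.ker (S.g ≫ j).hom :=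
    (LinearMap.exact_iff.1 <| hj.comp_exact_iff_exact.2 <|
      (ShortComplex.ShortExact.moduleCat_exact_iff_function_exact S).1 hS.exact).symm
  exact ⟨(LinearEquiv.ofInjective S.f.hom hS.moduleCat_injective_f).trans (.ofEq _ _ hrange)⟩

end Splicing

section Characterization

variable {R : Type u} [Ring R] {𝔛 𝒮 : ObjectProperty (ModuleCat.{u} R)}

lemma exists_seq_of_forall_exists {α : Type*} {p : α → Prop} {r : α → α → Prop}
    (h : ∀ a, p a → ∃ b, p b ∧ r a b) {a : α} (ha : p a) :
    ∃ z : ℕ → α, z 0 = a ∧ ∀ n, p (z n) ∧ r (z n) (z (n + 1)) := by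
  choose next hp hr using h
  let z : ℕ → Subtype p := fun n => Nat.rec ⟨a, ha⟩ (fun _ b => ⟨next b.1 b.2, hp b.1 b.2⟩) n
  exact ⟨fun n => (z n).1, rfl, fun n => ⟨(z n).2, hr (z n).1 (z n).2⟩⟩

namespace IsXGorensteinProjective

lemma of_isSyzygy_sequences {Z C : ℕ → ModuleCat.{u} R} (hZ : ∀ n, IsSyzygy (Z (n + 1)) (Z n))
    (hZC : IsSyzygy (Z 0) (C 0)) (hC : ∀ n, IsSyzygy (C n) (C (n + 1)))
    (hZX : ∀ n X, 𝔛 X → Subsingleton (Ext (Z n) X 1))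
    (hCX : ∀ n X, 𝔛 X → Subsingleton (Ext (C n) X 1)) : IsXGorensteinProjective 𝔛 (Z 0) := by
  choose T i p wT hT hZS using hZ
  choose Q j q wQ hQ hCS using hC
  obtain ⟨P, ι, π, w, hP, hS⟩ := hZC
  let W : TwoSidedSequence R :=
    { left := fun | 0 => P | n + 1 => T n
      right := Q
      dLeft := fun | 0 => p 0 ≫ ι | n + 1 => p (n + 1) ≫ i n
      mid := π ≫ j 0
      dRight := fun n => q n ≫ j (n + 1) }
  have hp (n : ℕ) := (hZS n).moduleCat_surjective_g
  have hj (n : ℕ) := (hCS n).moduleCat_injective_f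
  have hW : W.IsExact :=
    { left_succ := fun
        | 0 => exact_splice (hZS 0) (hp 1) hS.moduleCat_injective_f
        | n + 1 => exact_splice (hZS (n + 1)) (hp (n + 2)) (hZS n).moduleCat_injective_f
      left_zero := exact_splice hS (hp 0) (hj 0)
      right_zero := exact_splice (hCS 0) hS.moduleCat_surjective_g (hj 1)
      right_succ := fun n =>
        exact_splice (hCS (n + 1)) (hCS n).moduleCat_surjective_g (hj (n + 2)) }
  have hWX (X : ModuleCat.{u} R) (hX : 𝔛 X) : W.IsHomExact X :=
    have hι := exists_extension_of_subsingleton_ext_one hS (hCX 0 X hX)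
    have hi (n : ℕ) := exists_extension_of_subsingleton_ext_one (hZS n) (hZX n X hX)
    have hj (n : ℕ) := exists_extension_of_subsingleton_ext_one (hCS n) (hCX (n + 1) X hX)
    { left_succ := fun
        | 0 => hom_exact_splice (hZS 0) (hZS 1).epi_g hι
        | n + 1 => hom_exact_splice (hZS (n + 1)) (hZS (n + 2)).epi_g (hi n)
      left_zero := hom_exact_splice hS (hZS 0).epi_g (hj 0)
      right_zero := hom_exact_splice (hCS 0) hS.epi_g (hj 1)
      right_succ := fun n => hom_exact_splice (hCS (n + 1)) (hCS n).epi_g (hj (n + 2)) }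
  have hWproj (n : ℕ) : Projective (W.left n) := by
    cases n
    exacts [hP, hT _]
  exact ⟨W, ⟨fun n => ModuleCat.projective_of_module_projective _,
    fun n => ModuleCat.projective_of_module_projective (Q n), hW, hWX⟩,
    nonempty_linearEquiv_ker_comp hS (hj 0)⟩

lemma of_isSyzygy_closed (hsyz : ∀ G, 𝒮 G → ∃ K, 𝒮 K ∧ IsSyzygy K G)
    (hcosyz : ∀ G, 𝒮 G → ∃ G', 𝒮 G' ∧ IsSyzygy G G')
    (hext : ∀ G X, 𝒮 G → 𝔛 X → Subsingleton (Ext G X 1)) : 𝒮 ≤ IsXGorensteinProjective 𝔛 := by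
  intro G hG
  obtain ⟨G', hG', hGG'⟩ := hcosyz G hG
  obtain ⟨Z, rfl, hZ⟩ := exists_seq_of_forall_exists hsyz hG
  obtain ⟨C, rfl, hC⟩ := exists_seq_of_forall_exists hcosyz hG'
  exact of_isSyzygy_sequences (fun n => (hZ n).2) hGG' (fun n => (hC n).2)
    (fun n X => hext _ X (hZ n).1) (fun n X => hext _ X (hC n).1)

end IsXGorensteinProjective

end Characterization

section Dimension

variable {R : Type u} [Ring R] {𝔛 : ObjectProperty (ModuleCat.{u} R)} {M : ModuleCat.{u} R} {n : ℕ}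

/-- The right `Ext`-orthogonal class of the `𝔛`-Gorenstein projective modules, against which their
relative dimension is tested. -/
abbrev xGorensteinOrthogonal (𝔛 : ObjectProperty (ModuleCat.{u} R)) :
    ObjectProperty (ModuleCat.{u} R) :=
  rightExtOrthogonal (IsXGorensteinProjective 𝔛)

lemma le_xGorensteinOrthogonal : 𝔛 ≤ xGorensteinOrthogonal 𝔛 :=
  le_rightExtOrthogonal (fun _ hG => hG.exists_isSyzygy) fun _ _ hG hX => hG.subsingleton_ext_one hX

lemma isResolving_xGorensteinOrthogonal
    (h𝔛 : ∀ P : ModuleCat.{u} R, Module.Projective R P → 𝔛 P) :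
    IsResolving (xGorensteinOrthogonal 𝔛) :=
  rightExtOrthogonal_isResolving (fun _ hG => hG.exists_isSyzygy_of) fun P _ =>
    le_xGorensteinOrthogonal P (h𝔛 P (ModuleCat.projective_of_module_projective P))

namespace XGorensteinResolution

/-- The resolution `0 → G_{n+1} → ⋯ → G_1` of the kernel of the augmentation `G_0 → M`. -/
def syzygy (r : XGorensteinResolution 𝔛 M (n + 1)) :
    XGorensteinResolution 𝔛 (ModuleCat.of R (LinearMap.ker r.augmentation.hom)) n where
  obj i := r.obj (i + 1)
  d i := r.d (i + 1)
  augmentation := ModuleCat.ofHom <|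
    (r.d 0).hom.codRestrict _ r.exact_zero.apply_apply_eq_zero
  augmentation_surjective := by
    rintro ⟨y, hy⟩
    obtain ⟨x, hx⟩ := (r.exact_zero y).1 hy
    exact ⟨x, Subtype.ext hx⟩
  exact_zero x := Subtype.ext_iff.trans (r.exact_succ 0 x)
  exact_succ i := r.exact_succ (i + 1)
  gorenstein i hi := r.gorenstein (i + 1) (Nat.succ_le_succ hi)
  zero_of_lt i hi := r.zero_of_lt (i + 1) (Nat.succ_lt_succ hi)

/-- The resolution `0 → G → G → 0` of an `𝔛`-Gorenstein projective module `G`. -/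
def ofIsXGorensteinProjective (hM : IsXGorensteinProjective 𝔛 M) :
    XGorensteinResolution 𝔛 M 0 where
  obj := fun | 0 => M | _ + 1 => ModuleCat.of R PUnit
  d _ := 0
  augmentation := 𝟙 M
  augmentation_surjective := Function.surjective_id
  exact_zero x := ⟨fun hx => ⟨0, hx.symm⟩, by rintro ⟨_, rfl⟩; rfl⟩
  exact_succ _ _ := ⟨fun _ => ⟨0, Subsingleton.elim (α := PUnit) _ _⟩, fun _ => rfl⟩
  gorenstein := fun | 0, _ => hM
  zero_of_lt := fun | _ + 1, _ => inferInstanceAs (Subsingleton PUnit)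

/-- The resolution `0 → G_n → ⋯ → G_0 → S.X₂` of `S.X₃` obtained by splicing a resolution
`0 → G_n → ⋯ → G_0` of `S.X₁` with a short exact sequence `S` whose middle term is `𝔛`-Gorenstein
projective. -/
def splice {S : ShortComplex (ModuleCat.{u} R)} (hS : S.ShortExact)
    (hG : IsXGorensteinProjective 𝔛 S.X₂) (r : XGorensteinResolution 𝔛 S.X₁ n) :
    XGorensteinResolution 𝔛 S.X₃ (n + 1) where
  obj := fun | 0 => S.X₂ | i + 1 => r.obj i
  d := fun | 0 => r.augmentation ≫ S.f | i + 1 => r.d i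
  augmentation := S.g
  augmentation_surjective := hS.moduleCat_surjective_g
  exact_zero := r.augmentation_surjective.comp_exact_iff_exact.2 <|
    (ShortComplex.ShortExact.moduleCat_exact_iff_function_exact S).1 hS.exact
  exact_succ := fun
    | 0 => hS.moduleCat_injective_f.comp_exact_iff_exact.2 r.exact_zero
    | i + 1 => r.exact_succ i
  gorenstein := fun
    | 0, _ => hG
    | i + 1, hi => r.gorenstein i (Nat.le_of_succ_le_succ hi)
  zero_of_lt := fun | i + 1, hi => r.zero_of_lt i (Nat.lt_of_succ_lt_succ hi)

lemma isXGorensteinProjective (r : XGorensteinResolution 𝔛 M 0) : IsXGorensteinProjective 𝔛 M := by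
  have := r.zero_of_lt 1 one_pos
  have hinj : Function.Injective r.augmentation.hom := by
    refine (injective_iff_map_eq_zero _).2 fun x hx => ?_
    obtain ⟨y, rfl⟩ := (r.exact_zero x).1 hx
    rw [Subsingleton.elim y 0, map_zero]
  exact (r.gorenstein 0 le_rfl).of_linearEquiv
    (.ofBijective r.augmentation.hom ⟨hinj, r.augmentation_surjective⟩)

lemma leftExtOrthogonal (r : XGorensteinResolution 𝔛 M n) :
    leftExtOrthogonal (xGorensteinOrthogonal 𝔛) n M := by
  induction n generalizing M with
  | zero => exact le_leftExtOrthogonal_rightExtOrthogonal M r.isXGorensteinProjective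
  | succ n ih =>
    exact leftExtOrthogonal_X₃ (LinearMap.shortExact_shortComplexKer r.augmentation_surjective)
      (ih r.syzygy) <| leftExtOrthogonal_mono n.succ.zero_le <|
        le_leftExtOrthogonal_rightExtOrthogonal _ (r.gorenstein 0 (n + 1).zero_le)

end XGorensteinResolution

lemma nonempty_xGorensteinResolution_of_leftExtOrthogonal
    {𝒲 : ObjectProperty (ModuleCat.{u} R)}
    (h𝒲 : leftExtOrthogonal 𝒲 0 ≤ IsXGorensteinProjective 𝔛) (hM : leftExtOrthogonal 𝒲 n M) :
    Nonempty (XGorensteinResolution 𝔛 M n) := by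
  induction n generalizing M with
  | zero => exact ⟨.ofIsXGorensteinProjective (h𝒲 M hM)⟩
  | succ n ih =>
    obtain ⟨K, hK⟩ := exists_isSyzygy M
    obtain ⟨r⟩ := ih (hK.leftExtOrthogonal hM)
    obtain ⟨P, i, p, w, hP, hS⟩ := hK
    exact ⟨.splice hS (h𝒲 P (leftExtOrthogonal_of_projective P)) r⟩

lemma leftExtOrthogonal_of_xGpd_le (h : xGpd 𝔛 M ≤ n) :
    leftExtOrthogonal (xGorensteinOrthogonal 𝔛) n M := by
  have hne : {k : ℕ∞ | ∃ n : ℕ, k = n ∧ Nonempty (XGorensteinResolution 𝔛 M n)}.Nonempty := by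
    by_contra! hempty
    rw [xGpd, hempty, sInf_empty, top_le_iff] at h
    exact ENat.natCast_ne_top n h
  obtain ⟨m, hm, ⟨r⟩⟩ := csInf_mem hne
  exact leftExtOrthogonal_mono (Nat.cast_le.1 (hm.symm.trans_le h)) r.leftExtOrthogonal

lemma leftExtOrthogonal_zero_le_isXGorensteinProjective
    (h𝔛 : ∀ P : ModuleCat.{u} R, Module.Projective R P → 𝔛 P)
    (hn : ∀ M, leftExtOrthogonal (xGorensteinOrthogonal 𝔛) n M) :
    leftExtOrthogonal (xGorensteinOrthogonal 𝔛) 0 ≤ IsXGorensteinProjective 𝔛 := by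
  have hres := isResolving_xGorensteinOrthogonal h𝔛
  refine IsXGorensteinProjective.of_isSyzygy_closed (fun G hG => ?_) (fun G hG => ?_)
    fun G X hG hX => hG X (le_xGorensteinOrthogonal X hX) 1 one_pos
  · obtain ⟨K, hK⟩ := exists_isSyzygy G
    exact ⟨K, hK.leftExtOrthogonal (leftExtOrthogonal_mono zero_le_one hG), hK⟩
  · exact hres.exists_isSyzygy_of_leftExtOrthogonal
      (fun E _ => rightExtOrthogonal_of_injective E) hn hG

lemma leftExtOrthogonal_of_forall_ideal {𝒲 : ObjectProperty (ModuleCat.{u} R)}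
    (h : ∀ I : Ideal R, leftExtOrthogonal 𝒲 n (ModuleCat.of R (R ⧸ I))) (M : ModuleCat.{u} R) :
    leftExtOrthogonal 𝒲 n M := by
  intro W hW i hi
  have := hasInjectiveDimensionLE_of_forall_ideal fun I => h I W hW (n + 1) n.lt_succ_self
  exact HasInjectiveDimensionLT.subsingleton W (n + 1) i hi M

lemma leftXGgldim_le_of_forall_ideal (h𝔛 : ∀ P : ModuleCat.{u} R, Module.Projective R P → 𝔛 P)
    (h : ∀ I : Ideal R, xGpd 𝔛 (ModuleCat.of R (R ⧸ I)) ≤ n) : leftXGgldim 𝔛 ≤ n := by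
  have hn (M : ModuleCat.{u} R) : leftExtOrthogonal (xGorensteinOrthogonal 𝔛) n M :=
    leftExtOrthogonal_of_forall_ideal (fun I => leftExtOrthogonal_of_xGpd_le (h I)) M
  exact iSup_le fun M => sInf_le ⟨n, rfl, nonempty_xGorensteinResolution_of_leftExtOrthogonal
    (leftExtOrthogonal_zero_le_isXGorensteinProjective h𝔛 hn) (hn M)⟩

end Dimension

theorem mainTheorem1 {R : Type u} [Ring R] (𝔛 : ObjectProperty (ModuleCat.{u} R))
    (h𝔛 : ∀ P : ModuleCat.{u} R, Module.Projective R P → 𝔛 P) :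
    (∀ n : ℕ, List.TFAE
      [leftXGgldim 𝔛 ≤ n,
       ∀ M : ModuleCat.{u} R, Module.Finite R M → xGpd 𝔛 M ≤ n,
       ∀ I : Ideal R, xGpd 𝔛 (ModuleCat.of R (R ⧸ I)) ≤ n]) ∧
    leftXGgldim 𝔛 = (⨆ (M : ModuleCat.{u} R) (_ : Module.Finite R M), xGpd 𝔛 M) ∧
    leftXGgldim 𝔛 = (⨆ I : Ideal R, xGpd 𝔛 (ModuleCat.of R (R ⧸ I))) := by
  have hquot : leftXGgldim 𝔛 ≤ ⨆ I : Ideal R, xGpd 𝔛 (ModuleCat.of R (R ⧸ I)) := by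
    induction hs : ⨆ I : Ideal R, xGpd 𝔛 (ModuleCat.of R (R ⧸ I)) using ENat.recTopCoe with
    | top => exact le_top
    | coe n =>
      exact leftXGgldim_le_of_forall_ideal h𝔛 fun I =>
        (le_iSup (fun I : Ideal R => xGpd 𝔛 (ModuleCat.of R (R ⧸ I))) I).trans hs.le
  have hfin : (⨆ I : Ideal R, xGpd 𝔛 (ModuleCat.of R (R ⧸ I))) ≤
      ⨆ (M : ModuleCat.{u} R) (_ : Module.Finite R M), xGpd 𝔛 M :=
    iSup_le fun I => le_iSup₂_of_le (ModuleCat.of R (R ⧸ I))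
      (inferInstanceAs (Module.Finite R (R ⧸ I))) le_rfl
  have hall : (⨆ (M : ModuleCat.{u} R) (_ : Module.Finite R M), xGpd 𝔛 M) ≤ leftXGgldim 𝔛 :=
    iSup₂_le fun M _ => le_iSup (fun M : ModuleCat.{u} R => xGpd 𝔛 M) M
  refine ⟨fun n => ?_, le_antisymm (hquot.trans hfin) hall,
    le_antisymm hquot (hfin.trans hall)⟩
  tfae_have 1 → 2 := fun h M _ => (le_iSup (fun M : ModuleCat.{u} R => xGpd 𝔛 M) M).trans h
  tfae_have 2 → 3 := fun h I =>
    h (ModuleCat.of R (R ⧸ I)) (inferInstanceAs (Module.Finite R (R ⧸ I)))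
  tfae_have 3 → 1 := leftXGgldim_le_of_forall_ideal h𝔛
  tfae_finish
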